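/- Let $\mathbb{L}$ be a distributive lattice with minimum $m$ and maximum $M$. Let $\mathbb{L}^*$ be the set of all lattice homomorphisms $x^*\colon\mathbb{L}\to[-1,1]$, and put $\delta_x(x^*)=x^*(x)$ for $x\in\mathbb{L}$, $x^*\in\mathbb{L}^*$. For $f\colon\mathbb{L}^*\to\mathbb{R}$ let $$\|f\|=\sup\Big\{\sum_{i=1}^n|f(x_i^*)| : n\in\mathbb{N},\ x_1^*,\dots,x_n^*\in\mathbb{L}^*,\ \sup_{x\in\mathbb{L}}\sum_{i=1}^n|x_i^*(x)|\le 1\Big\}.$$ Let $FBL\langle\mathbb{L}\rangle$ be the free Banach lattice generated by $\mathbb{L}$, realized as the closed vector sublattice generated by $\{\delta_x : x\in\mathbb{L}\}$ in the Banach lattice of all $f\colon\mathbb{L}^*\to\mathbb{R}$ with $\|f\|<\infty$ (pointwise operations and order, norm $\|\cdot\|$). Let $$K_{\mathbb{L}}=\{x^*\in\mathbb{L}^* : \max\{|x^*(m)|,|x^*(M)|\}=1\}\subseteq[-1,1]^{\mathbb{L}}$$ carry the product topology. Then $K_{\mathbb{L}}$ is compact and $FBL\langle\mathbb{L}\rangle$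 is $2$-lattice isomorphic to $C(K_{\mathbb{L}})$ with the supremum norm; that is, there is a linear lattice isomorphism $T$ from $FBL\langle\mathbb{L}\rangle$ onto $C(K_{\mathbb{L}})$ such that $T$ and $T^{-1}$ are bounded and $\|T\|\,\|T^{-1}\|\le 2$. The same holds when $FBL\langle\mathbb{L}\rangle$ is taken in the sense of the universal property: if $X$ is a Banach lattice and $\delta\colon\mathbb{L}\to X$ is a lattice homomorphism with bounded range such that for every Banach lattice $Y$ and every norm-bounded lattice homomorphism $S\colon\mathbb{L}\to Y$ there is a unique Banach lattice homomorphism $\hat S\colon X\to Y$ with $\hat S\circ\delta=S$, and moreover $\|\hat S\|=\sup_{x\in\mathbb{L}}\|S(x)\|$, then $X$ is $2$-lattice isomorphic to $C(K_{\mathbb{L}})$. -/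

import Mathlib

open scoped ENNReal

universe u v

namespace FreeBanachLattice

/-! ### Lattice homomorphisms between Banach lattices, and `c`-lattice isomorphisms -/

section Morphisms

variable {X Y : Type*} [NormedAddCommGroup X] [NormedSpace ℝ X] [Lattice X]
  [NormedAddCommGroup Y] [NormedSpace ℝ Y] [Lattice Y]

/-- A bounded linear operator that preserves finite suprema and infima. -/
def IsBanachLatticeHom (T : X →L[ℝ] Y) : Prop :=
  (∀ x y, T (x ⊔ y) = T x ⊔ T y) ∧ (∀ x y, T (x ⊓ y) = T x ⊓ T y)

variable (X Y) in
/-- `X` and `Y` are `c`-lattice isomorphic: there is a surjective linear lattice isomorphism `T`,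
bounded together with its inverse, such that `‖T‖ * ‖T⁻¹‖ ≤ c`. -/
def LatticeIsomorphicWith (c : ℝ) : Prop :=
  ∃ T : X ≃L[ℝ] Y, IsBanachLatticeHom (T : X →L[ℝ] Y) ∧
    ‖(T : X →L[ℝ] Y)‖ * ‖(T.symm : Y →L[ℝ] X)‖ ≤ c

end Morphisms

/-! ### The universal property -/

/-- `X`, together with the lattice homomorphism `δ : L → X` of bounded range, is a free Banach
lattice generated by the lattice `L`: every norm-bounded lattice homomorphism `T` from `L` to a
Banach lattice `Y` extends uniquely to a Banach lattice homomorphism `X → Y`, and the norm of the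
extension is `sup {‖T a‖ : a ∈ L}`. -/
structure IsFreeBanachLattice {L : Type u} [Lattice L] {X : Type v} [NormedAddCommGroup X]
    [NormedSpace ℝ X] [Lattice X] (δ : LatticeHom L X) : Prop where
  isBounded_range : Bornology.IsBounded (Set.range δ)
  exists_unique_extension : ∀ (Y : Type v) [NormedAddCommGroup Y] [NormedSpace ℝ Y] [Lattice Y]
    [IsOrderedAddMonoid Y] [IsOrderedModule ℝ Y] [HasSolidNorm Y] [CompleteSpace Y]
    (T : LatticeHom L Y), Bornology.IsBounded (Set.range T) →
      ∃ T' : X →L[ℝ] Y, IsBanachLatticeHom T' ∧ (∀ a, T' (δ a) = T a) ∧ ‖T'‖ = ⨆ a, ‖T a‖ ∧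
        ∀ S : X →L[ℝ] Y, IsBanachLatticeHom S → (∀ a, S (δ a) = T a) → S = T'

/-! ### The concrete free Banach lattice -/

section Concrete

variable (L : Type u) [Lattice L]

/-- The set `L*` of lattice homomorphisms `L → [-1, 1]`, as a subset of `L → ℝ`. -/
def dualSet : Set (L → ℝ) :=
  {x | (∀ a, x a ∈ Set.Icc (-1 : ℝ) 1) ∧ (∀ a b, x (a ⊔ b) = x a ⊔ x b) ∧
    ∀ a b, x (a ⊓ b) = x a ⊓ x b}

/-- The set `L*` as a type. -/
abbrev Dual : Type u := ↥(dualSet L)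

variable {L}

/-- The `[0, ∞]`-valued norm of a function `f : L* → ℝ`: the supremum of `∑ |f (xᵢ)|` over all
finite families `xᵢ` in `L*` such that `∑ |xᵢ a| ≤ 1` for all `a`. -/
noncomputable def eNorm (f : Dual L → ℝ) : ℝ≥0∞ :=
  ⨆ (n : ℕ) (x : Fin n → Dual L) (_ : ∀ a, ∑ i, |(x i).1 a| ≤ 1), ∑ i, ‖f (x i)‖ₑ

lemma sum_le_eNorm (f : Dual L → ℝ) {n : ℕ} (x : Fin n → Dual L)
    (hx : ∀ a, ∑ i, |(x i).1 a| ≤ 1) : ∑ i, ‖f (x i)‖ₑ ≤ eNorm f :=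
  le_iSup_of_le n (le_iSup_of_le x (le_iSup_of_le hx le_rfl))

lemma eNorm_le {f : Dual L → ℝ} {c : ℝ≥0∞}
    (h : ∀ (n : ℕ) (x : Fin n → Dual L), (∀ a, ∑ i, |(x i).1 a| ≤ 1) → ∑ i, ‖f (x i)‖ₑ ≤ c) :
    eNorm f ≤ c :=
  iSup_le fun n => iSup_le fun x => iSup_le fun hx => h n x hx

lemma enorm_apply_le_eNorm (f : Dual L → ℝ) (x : Dual L) : ‖f x‖ₑ ≤ eNorm f := by
  have h := sum_le_eNorm f (fun _ : Fin 1 => x) (fun a => by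
    simpa using abs_le.2 ⟨(x.2.1 a).1, (x.2.1 a).2⟩)
  simpa using h

lemma eNorm_zero : eNorm (0 : Dual L → ℝ) = 0 :=
  le_antisymm (eNorm_le fun _ x _ => by simp) zero_le

lemma eNorm_add_le (f g : Dual L → ℝ) : eNorm (f + g) ≤ eNorm f + eNorm g :=
  eNorm_le fun _ x hx => calc
    ∑ i, ‖(f + g) (x i)‖ₑ ≤ ∑ i, (‖f (x i)‖ₑ + ‖g (x i)‖ₑ) :=
      Finset.sum_le_sum fun _ _ => enorm_add_le _ _
    _ = ∑ i, ‖f (x i)‖ₑ + ∑ i, ‖g (x i)‖ₑ := Finset.sum_add_distrib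
    _ ≤ eNorm f + eNorm g := add_le_add (sum_le_eNorm f x hx) (sum_le_eNorm g x hx)

lemma eNorm_mono {f g : Dual L → ℝ} (h : |f| ≤ |g|) : eNorm f ≤ eNorm g :=
  eNorm_le fun _ x hx => (Finset.sum_le_sum fun i _ =>
    enorm_le_iff_norm_le.2 (h (x i))).trans (sum_le_eNorm g x hx)

lemma eNorm_smul_le (c : ℝ) (f : Dual L → ℝ) : eNorm (c • f) ≤ ‖c‖ₑ * eNorm f :=
  eNorm_le fun _ x hx => by
    simp only [Pi.smul_apply, smul_eq_mul, enorm_mul, ← Finset.mul_sum]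
    exact mul_le_mul_right (sum_le_eNorm f x hx) _

lemma eNorm_abs (f : Dual L → ℝ) : eNorm |f| = eNorm f :=
  le_antisymm (eNorm_mono (abs_abs f).le) (eNorm_mono (abs_abs f).ge)

lemma eNorm_eval_le (a : L) : eNorm (fun x : Dual L => x.1 a) ≤ 1 :=
  eNorm_le fun _ x hx => by
    have h : ∑ i, ‖(x i).1 a‖ₑ = ENNReal.ofReal (∑ i, |(x i).1 a|) := by
      rw [ENNReal.ofReal_sum_of_nonneg fun _ _ => abs_nonneg _]
      exact Finset.sum_congr rfl fun i _ => Real.enorm_eq_ofReal_abs _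
    rw [h]
    exact ENNReal.ofReal_le_one.2 (hx a)

variable (L)

/-- The functions `f : L* → ℝ` of finite norm, as a subspace of the space of all functions. -/
noncomputable def finiteNormSubmodule : Submodule ℝ (Dual L → ℝ) where
  carrier := {f | eNorm f < ∞}
  add_mem' {f g} hf hg := (eNorm_add_le f g).trans_lt (ENNReal.add_lt_top.2 ⟨hf, hg⟩)
  zero_mem' := by simp [eNorm_zero]
  smul_mem' c f hf := (eNorm_smul_le c f).trans_lt (ENNReal.mul_lt_top enorm_lt_top hf)

/-- The space of all functions `f : L* → ℝ` of finite norm, with the pointwise operations and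
order. It is a type of its own, so that it does not inherit the topology of pointwise convergence:
its topology is the one of the norm below. -/
def FiniteNormFn : Type u := ↥(finiteNormSubmodule L)

namespace FiniteNormFn

noncomputable instance : AddCommGroup (FiniteNormFn L) :=
  inferInstanceAs (AddCommGroup ↥(finiteNormSubmodule L))

noncomputable instance : Module ℝ (FiniteNormFn L) :=
  inferInstanceAs (Module ℝ ↥(finiteNormSubmodule L))

variable {L}

lemma eNorm_lt_top (f : FiniteNormFn L) : eNorm f.1 < ∞ := f.2

lemma sup_mem (f g : FiniteNormFn L) : f.1 ⊔ g.1 ∈ finiteNormSubmodule L := by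
  have h : eNorm (f.1 ⊔ g.1) ≤ eNorm (|f.1| + |g.1|) := eNorm_mono fun x => by
    simp only [Pi.abs_apply, Pi.sup_apply, Pi.add_apply]
    rw [abs_of_nonneg (add_nonneg (abs_nonneg (f.1 x)) (abs_nonneg (g.1 x)))]
    rcases le_total (f.1 x) (g.1 x) with h | h <;> simp [h]
  refine (h.trans (eNorm_add_le _ _)).trans_lt (ENNReal.add_lt_top.2 ⟨?_, ?_⟩) <;>
    rw [eNorm_abs] <;> exact eNorm_lt_top _

lemma inf_mem (f g : FiniteNormFn L) : f.1 ⊓ g.1 ∈ finiteNormSubmodule L := by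
  have h : eNorm (f.1 ⊓ g.1) ≤ eNorm (|f.1| + |g.1|) := eNorm_mono fun x => by
    simp only [Pi.abs_apply, Pi.inf_apply, Pi.add_apply]
    rw [abs_of_nonneg (add_nonneg (abs_nonneg (f.1 x)) (abs_nonneg (g.1 x)))]
    rcases le_total (f.1 x) (g.1 x) with h | h <;> simp [h]
  refine (h.trans (eNorm_add_le _ _)).trans_lt (ENNReal.add_lt_top.2 ⟨?_, ?_⟩) <;>
    rw [eNorm_abs] <;> exact eNorm_lt_top _

/-- The pointwise order and lattice operations. -/
noncomputable instance : Lattice (FiniteNormFn L) :=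
  Subtype.lattice (P := fun f : Dual L → ℝ => f ∈ finiteNormSubmodule L)
    (fun {f g} hf hg => sup_mem ⟨f, hf⟩ ⟨g, hg⟩) (fun {f g} hf hg => inf_mem ⟨f, hf⟩ ⟨g, hg⟩)

/-- The norm, now real valued. -/
noncomputable instance : Norm (FiniteNormFn L) := ⟨fun f => (eNorm f.1).toReal⟩

lemma norm_def (f : FiniteNormFn L) : ‖f‖ = (eNorm f.1).toReal := rfl

lemma core : NormedSpace.Core ℝ (FiniteNormFn L) where
  norm_nonneg f := ENNReal.toReal_nonneg
  norm_smul c f := by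
    have hle : ∀ (c : ℝ) (f : FiniteNormFn L), ‖c • f‖ ≤ ‖c‖ * ‖f‖ := fun c f => by
      have h := ENNReal.toReal_mono (ENNReal.mul_lt_top enorm_lt_top (eNorm_lt_top f)).ne
        (eNorm_smul_le c f.1)
      rwa [ENNReal.toReal_mul, toReal_enorm] at h
    refine le_antisymm (hle c f) ?_
    rcases eq_or_ne c 0 with rfl | hc
    · rw [norm_zero, zero_mul]
      exact ENNReal.toReal_nonneg
    · have h := hle c⁻¹ (c • f)
      rw [inv_smul_smul₀ hc, norm_inv] at h
      have hc' : 0 < ‖c‖ := norm_pos_iff.2 hc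
      calc ‖c‖ * ‖f‖ ≤ ‖c‖ * (‖c‖⁻¹ * ‖c • f‖) := mul_le_mul_of_nonneg_left h hc'.le
        _ = ‖c • f‖ := by rw [← mul_assoc, mul_inv_cancel₀ hc'.ne', one_mul]
  norm_triangle f g := by
    have h := ENNReal.toReal_mono (ENNReal.add_lt_top.2 ⟨eNorm_lt_top f, eNorm_lt_top g⟩).ne
      (eNorm_add_le f.1 g.1)
    rwa [ENNReal.toReal_add (eNorm_lt_top f).ne (eNorm_lt_top g).ne] at h
  norm_eq_zero_iff f := by
    constructor
    · intro h
      have h0 : eNorm f.1 = 0 :=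
        ((ENNReal.toReal_eq_zero_iff _).1 h).resolve_right (eNorm_lt_top f).ne
      refine Subtype.ext (funext fun x => ?_)
      have hx := enorm_apply_le_eNorm f.1 x
      rw [h0] at hx
      exact enorm_eq_zero.1 (le_antisymm hx zero_le)
    · rintro rfl
      change (eNorm (0 : Dual L → ℝ)).toReal = 0
      rw [eNorm_zero, ENNReal.toReal_zero]

noncomputable instance : NormedAddCommGroup (FiniteNormFn L) := NormedAddCommGroup.ofCore core

noncomputable instance : NormedSpace ℝ (FiniteNormFn L) := NormedSpace.ofCore core

/-- The evaluation function `δ_a`, `δ_a x = x a`. -/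
def eval (a : L) : FiniteNormFn L :=
  ⟨fun x => x.1 a, (eNorm_eval_le a).trans_lt ENNReal.one_lt_top⟩

end FiniteNormFn

/-- The closed vector sublattice generated by the evaluation functions: the intersection of all
norm-closed linear subspaces of `FiniteNormFn L` that are closed under `⊔` and `⊓` and contain
every `δ_a`. -/
noncomputable def fblSubmodule : Submodule ℝ (FiniteNormFn L) :=
  sInf {S | IsClosed (S : Set (FiniteNormFn L)) ∧ (∀ f ∈ S, ∀ g ∈ S, f ⊔ g ∈ S) ∧
    (∀ f ∈ S, ∀ g ∈ S, f ⊓ g ∈ S) ∧ ∀ a, FiniteNormFn.eval a ∈ S}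

/-- The free Banach lattice `FBL⟨L⟩` generated by the lattice `L`. -/
abbrev FBL : Type u := ↥(fblSubmodule L)

variable {L} in
lemma sup_mem_fbl {f g : FiniteNormFn L} (hf : f ∈ fblSubmodule L) (hg : g ∈ fblSubmodule L) :
    f ⊔ g ∈ fblSubmodule L := by
  rw [fblSubmodule, Submodule.mem_sInf] at *
  exact fun S hS => hS.2.1 f (hf S hS) g (hg S hS)

variable {L} in
lemma inf_mem_fbl {f g : FiniteNormFn L} (hf : f ∈ fblSubmodule L) (hg : g ∈ fblSubmodule L) :
    f ⊓ g ∈ fblSubmodule L := by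
  rw [fblSubmodule, Submodule.mem_sInf] at *
  exact fun S hS => hS.2.2.1 f (hf S hS) g (hg S hS)

/-- The pointwise order and lattice operations of `FBL⟨L⟩`. -/
noncomputable instance : Lattice (FBL L) :=
  Subtype.lattice (fun _ _ hf hg => sup_mem_fbl hf hg) (fun _ _ hf hg => inf_mem_fbl hf hg)

end Concrete

/-! ### The compact space `K_L` -/

section CompactSpace

variable (L : Type u) [Lattice L] [BoundedOrder L]

/-- The set `K_L` of all `x ∈ L*` such that `max {|x m|, |x M|} = 1`, where `m` is the minimum and
`M` the maximum of `L`; its topology is that of the product `L → ℝ`. -/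
def compactSet : Set (L → ℝ) := {x | x ∈ dualSet L ∧ max |x ⊥| |x ⊤| = 1}

/-- The topological space `K_L`. -/
abbrev K : Type u := ↥(compactSet L)

instance : CompactSpace (K L) := by
  refine isCompact_iff_compactSpace.1 ?_
  have hI : IsCompact (Set.univ.pi fun _ : L => Set.Icc (-1 : ℝ) 1) :=
    isCompact_univ_pi fun _ => isCompact_Icc
  refine hI.of_isClosed_subset ?_ fun x hx a _ => hx.1.1 a
  have h1 : IsClosed {x : L → ℝ | ∀ a, x a ∈ Set.Icc (-1 : ℝ) 1} := by
    simp only [Set.ofPred_forall]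
    exact isClosed_iInter fun a => isClosed_Icc.preimage (continuous_apply a)
  have h2 : IsClosed {x : L → ℝ | ∀ a b, x (a ⊔ b) = x a ⊔ x b} := by
    simp only [Set.ofPred_forall]
    exact isClosed_iInter fun a => isClosed_iInter fun b =>
      isClosed_eq (continuous_apply _) ((continuous_apply a).sup (continuous_apply b))
  have h3 : IsClosed {x : L → ℝ | ∀ a b, x (a ⊓ b) = x a ⊓ x b} := by
    simp only [Set.ofPred_forall]
    exact isClosed_iInter fun a => isClosed_iInter fun b =>
      isClosed_eq (continuous_apply _) ((continuous_apply a).inf (continuous_apply b))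
  have h4 : IsClosed {x : L → ℝ | max |x ⊥| |x ⊤| = 1} :=
    isClosed_eq ((continuous_apply ⊥).abs.max (continuous_apply ⊤).abs) continuous_const
  exact (h1.inter (h2.inter h3)).inter h4

end CompactSpace

end FreeBanachLattice

/-! A lattice homomorphism `x : L → [-1, 1]` is monotone, so `max |x ⊥| |x ⊤|` is its supremum norm
and `K_L` is the unit sphere of `L*`. Both halves use a lattice homomorphism `J` into `C(K_L)`
sending `δ_a` to evaluation at `a`. If `‖J f‖ ≤ ‖f‖ ≤ 2 ‖J f‖`, then `J` is injective with closed
range, and the range is dense by the lattice form of Stone–Weierstrass: it separates points and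
contains `|δ_⊥| ⊔ |δ_⊤| = 1`. Only the lower bound differs between the halves.

In the concrete model, `J` is restriction to `K_L`. Members of `FBL⟨L⟩` are positively homogeneous,
so `|f x| ≤ max |x ⊥| |x ⊤| * ‖J f‖`; summed over an admissible family, the two terms `|x ⊥|` and
`|x ⊤|` contribute at most `1` each.

For the universal property, `J f` evaluates at `f` the real extensions of the points of `K_L`. With
`u = |δ ⊥| ⊔ |δ ⊤|`, of norm at most `2`, the goal is `|f| ≤ (‖J f‖ + ε) • u`. By a Kakutani-type
argument, real lattice homomorphisms `φ` on the order ideal of `u` with `φ u = 1` detect such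
inequalities. Each one composed with `δ` is a point of `K_L`, so `φ f ≤ ‖J f‖` for `f` in the vector
sublattice generated by `δ`; density gives the rest. -/

namespace FreeBanachLattice

/-! ### Density and the reduction to a lower bound -/

section StoneWeierstrass

variable {L : Type u} [Lattice L] [BoundedOrder L]

/-- Preserving suprema makes `x` monotone, which puts `x a` between `x ⊥` and `x ⊤`. -/
lemma abs_apply_le_max {x : L → ℝ} (hx : ∀ a b, x (a ⊔ b) = x a ⊔ x b) (a : L) :
    |x a| ≤ max |x ⊥| |x ⊤| := by
  have h1 : x ⊥ ≤ x a := by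
    have h := hx ⊥ a
    rw [bot_sup_eq] at h
    exact h ▸ le_sup_left
  have h2 : x a ≤ x ⊤ := by
    have h := hx a ⊤
    rw [sup_top_eq] at h
    exact h ▸ le_sup_left
  exact abs_le_max_abs_abs h1 h2

/-- A vector sublattice of `C(K_L)` that contains all evaluations is dense. -/
lemma dense_of_eval_mem (S : Submodule ℝ C(K L, ℝ)) (hsup : ∀ f ∈ S, ∀ g ∈ S, f ⊔ g ∈ S)
    (hinf : ∀ f ∈ S, ∀ g ∈ S, f ⊓ g ∈ S) (heval : ∀ a, ∃ f ∈ S, ∀ x : K L, f x = x.1 a) :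
    closure (S : Set C(K L, ℝ)) = Set.univ := by
  have hone : (1 : C(K L, ℝ)) ∈ S := by
    obtain ⟨f, hf, hf'⟩ := heval ⊥
    obtain ⟨g, hg, hg'⟩ := heval ⊤
    -- The normalization defining `K_L` says exactly that `|δ_⊥| ⊔ |δ_⊤|` is the constant `1` there.
    have h : (f ⊔ -f) ⊔ (g ⊔ -g) = 1 := by
      ext x
      have hx := x.2.2
      simpa [hf', hg', abs] using hx
    rw [← h]
    exact hsup _ (hsup _ hf _ (S.neg_mem hf)) _ (hsup _ hg _ (S.neg_mem hg))
  refine ContinuousMap.sublattice_closure_eq_top _ ⟨1, hone⟩ hinf hsup fun v x y => ?_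
  rcases eq_or_ne x y with rfl | hxy
  · exact ⟨v x • 1, S.smul_mem _ hone, by simp, by simp⟩
  obtain ⟨a, ha⟩ : ∃ a, x.1 a ≠ y.1 a := by
    by_contra! h
    exact hxy (Subtype.ext (funext h))
  obtain ⟨f, hf, hf'⟩ := heval a
  have ha' : y.1 a - x.1 a ≠ 0 := sub_ne_zero.2 ha.symm
  -- Affine interpolation in `δ_a` through the prescribed values at the two points.
  refine ⟨v x • 1 + ((v y - v x) / (y.1 a - x.1 a)) • (f - x.1 a • 1),
    S.add_mem (S.smul_mem _ hone) (S.smul_mem _ (S.sub_mem hf (S.smul_mem _ hone))), ?_, ?_⟩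
  · simp [hf']
  · simp [hf', ha']

/-- A bounded lattice homomorphism `J : X → C(K_L)` that is contractive, bounded below by `1 / 2`
and has all evaluations in its range is a lattice isomorphism with constant `2`. -/
theorem latticeIsomorphicWith_two_of_lowerBound {X : Type*} [NormedAddCommGroup X]
    [NormedSpace ℝ X] [Lattice X] [CompleteSpace X] (J : X →L[ℝ] C(K L, ℝ))
    (hJ : IsBanachLatticeHom J) (hle : ∀ f, ‖J f‖ ≤ ‖f‖) (hge : ∀ f, ‖f‖ ≤ 2 * ‖J f‖)
    (heval : ∀ a, ∃ f, ∀ x : K L, J f x = x.1 a) : LatticeIsomorphicWith X C(K L, ℝ) 2 := by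
  have hinj : Function.Injective J := (injective_iff_map_eq_zero J).2 fun f hf => by
    have h := hge f
    rw [hf, norm_zero, mul_zero] at h
    exact norm_le_zero_iff.1 h
  have hanti : AntilipschitzWith 2 J := J.antilipschitz_of_bound fun f => by simpa using hge f
  have hclosed : IsClosed (Set.range J) := hanti.isClosed_range J.uniformContinuous
  have hdense := dense_of_eval_mem (LinearMap.range (J : X →ₗ[ℝ] C(K L, ℝ)))
    (by rintro _ ⟨f, rfl⟩ _ ⟨g, rfl⟩; exact ⟨f ⊔ g, hJ.1 f g⟩)
    (by rintro _ ⟨f, rfl⟩ _ ⟨g, rfl⟩; exact ⟨f ⊓ g, hJ.2 f g⟩)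
    (fun a => (heval a).elim fun f hf => ⟨J f, ⟨f, rfl⟩, hf⟩)
  have hsurj : Function.Surjective J := by
    refine Set.range_eq_univ.1 ?_
    rw [← hdense]
    exact hclosed.closure_eq.symm
  let e := LinearEquiv.ofBijective (J : X →ₗ[ℝ] C(K L, ℝ)) ⟨hinj, hsurj⟩
  have he : ∀ g, ‖e.symm g‖ ≤ 2 * ‖g‖ := fun g => by
    have h := hge (e.symm g)
    have h' : J (e.symm g) = g := e.apply_symm_apply g
    rwa [h'] at h
  let T := e.toContinuousLinearEquivOfBounds 1 2 (fun f => (one_mul ‖f‖).symm ▸ hle f) he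
  refine ⟨T, hJ, ?_⟩
  have h1 : ‖(T : X →L[ℝ] C(K L, ℝ))‖ ≤ 1 :=
    ContinuousLinearMap.opNorm_le_bound _ zero_le_one fun f => (one_mul ‖f‖).symm ▸ hle f
  have h2 : ‖(T.symm : C(K L, ℝ) →L[ℝ] X)‖ ≤ 2 :=
    ContinuousLinearMap.opNorm_le_bound _ zero_le_two he
  calc _ ≤ 1 * (2 : ℝ) := mul_le_mul h1 h2 (ContinuousLinearMap.opNorm_nonneg _) zero_le_one
    _ = 2 := one_mul 2

end StoneWeierstrass

/-! ### Real lattice homomorphisms on a space with a strong unit -/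

section Kakutani

variable {V : Type*} [AddCommGroup V] [Module ℝ V] [Lattice V]

/-- A monotone sublinear functional that preserves binary suprema. -/
structure IsSupSublinear (p : V → ℝ) : Prop where
  mono : Monotone p
  sup_le : ∀ x y, p (x ⊔ y) ≤ max (p x) (p y)
  add_le : ∀ x y, p (x + y) ≤ p x + p y
  smul_le : ∀ s : ℝ, 0 < s → ∀ x, p (s • x) ≤ s * p x

namespace IsSupSublinear

variable {p q : V → ℝ}

lemma map_sup (hp : IsSupSublinear p) (x y : V) : p (x ⊔ y) = max (p x) (p y) :=
  le_antisymm (hp.sup_le x y) (max_le (hp.mono le_sup_left) (hp.mono le_sup_right))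

lemma map_zero (hp : IsSupSublinear p) : p 0 = 0 := by
  have h1 := hp.smul_le 2 two_pos 0
  have h2 := hp.smul_le (1 / 2) one_half_pos 0
  rw [smul_zero] at h1 h2
  linarith

lemma neg_le_map (hp : IsSupSublinear p) (x : V) : -p (-x) ≤ p x := by
  have h := hp.add_le x (-x)
  rw [add_neg_cancel, hp.map_zero] at h
  linarith

lemma map_smul_of_pos (hp : IsSupSublinear p) {s : ℝ} (hs : 0 < s) (x : V) :
    p (s • x) = s * p x := by
  refine le_antisymm (hp.smul_le s hs x) ?_
  have h := hp.smul_le s⁻¹ (inv_pos.2 hs) (s • x)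
  rw [inv_smul_smul₀ hs.ne'] at h
  calc s * p x ≤ s * (s⁻¹ * p (s • x)) := mul_le_mul_of_nonneg_left h hs.le
    _ = p (s • x) := by rw [← mul_assoc, mul_inv_cancel₀ hs.ne', one_mul]

/-- Pointwise infima of suitably directed families are sup-preserving and sublinear. -/
lemma iInf {ι : Type*} [Nonempty ι] {p : ι → V → ℝ} (hbdd : ∀ x, BddBelow (Set.range (p · x)))
    (hmono : ∀ i, Monotone (p i))
    (hsup : ∀ i j x y, ∃ k, p k (x ⊔ y) ≤ max (p i x) (p j y))
    (hadd : ∀ i j x y, ∃ k, p k (x + y) ≤ p i x + p j y)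
    (hsmul : ∀ i, ∀ s : ℝ, 0 < s → ∀ x, ∃ k, p k (s • x) ≤ s * p i x) :
    IsSupSublinear fun x => ⨅ i, p i x where
  mono x y hxy := ciInf_mono (hbdd x) fun i => hmono i hxy
  sup_le x y := by
    refine le_of_forall_gt_imp_ge_of_dense fun c hc => ?_
    obtain ⟨i, hi⟩ := exists_lt_of_ciInf_lt ((le_max_left _ _).trans_lt hc)
    obtain ⟨j, hj⟩ := exists_lt_of_ciInf_lt ((le_max_right _ _).trans_lt hc)
    obtain ⟨k, hk⟩ := hsup i j x y
    exact (ciInf_le (hbdd _) k).trans (hk.trans (max_le hi.le hj.le))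
  add_le x y := by
    refine le_ciInf_add_ciInf fun i j => ?_
    obtain ⟨k, hk⟩ := hadd i j x y
    exact (ciInf_le (hbdd _) k).trans hk
  smul_le s hs x := by
    rw [Real.mul_iInf_of_nonneg hs.le]
    refine le_ciInf fun i => ?_
    obtain ⟨k, hk⟩ := hsmul i s hs x
    exact (ciInf_le (hbdd _) k).trans hk

variable [IsOrderedAddMonoid V]

/-- The one-sided directional minorant `x ↦ inf {p (x + t z) - t p z : t ≥ 0}` of `p`. -/
lemma directional (hp : IsSupSublinear p) (z : V) :
    IsSupSublinear (fun x => ⨅ t : {t : ℝ // 0 ≤ t}, (p (x + t.1 • z) - t.1 * p z)) ∧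
      ∀ x (t : {t : ℝ // 0 ≤ t}),
        (⨅ t : {t : ℝ // 0 ≤ t}, (p (x + t.1 • z) - t.1 * p z)) ≤ p (x + t.1 • z) - t.1 * p z := by
  have hz : ∀ t : ℝ, 0 ≤ t → p (t • z) = t * p z := fun t ht => by
    rcases ht.eq_or_lt with rfl | ht
    · simp [hp.map_zero]
    · exact hp.map_smul_of_pos ht z
  have hbdd : ∀ x, BddBelow (Set.range fun t : {t : ℝ // 0 ≤ t} =>
      p (x + t.1 • z) - t.1 * p z) := fun x => by
    refine ⟨-p (-x), ?_⟩
    rintro _ ⟨t, rfl⟩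
    have h := hp.add_le (x + t.1 • z) (-x)
    rw [add_neg_cancel_comm, hz t.1 t.2] at h
    dsimp only
    linarith
  -- By subadditivity the family decreases in `t`. It is therefore directed, which is what lets the
  -- infimum still preserve suprema.
  have hanti : ∀ x (s t : {t : ℝ // 0 ≤ t}), s ≤ t →
      p (x + t.1 • z) - t.1 * p z ≤ p (x + s.1 • z) - s.1 * p z := fun x s t hst => by
    have h := hp.add_le (x + s.1 • z) ((t.1 - s.1) • z)
    rw [hz _ (sub_nonneg.2 hst), add_assoc, ← add_smul, add_sub_cancel] at h
    linarith
  refine ⟨IsSupSublinear.iInf hbdd ?_ ?_ ?_ ?_, fun x t => ciInf_le (hbdd x) t⟩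
  · intro t x y hxy
    exact sub_le_sub_right (hp.mono (add_le_add_left hxy _)) _
  · intro s t x y
    refine ⟨max s t, ?_⟩
    rw [sup_add, hp.map_sup, ← max_sub_sub_right]
    exact max_le_max (hanti x _ _ (le_max_left s t)) (hanti y _ _ (le_max_right s t))
  · intro s t x y
    refine ⟨⟨s.1 + t.1, add_nonneg s.2 t.2⟩, ?_⟩
    have h := hp.add_le (x + s.1 • z) (y + t.1 • z)
    rw [add_add_add_comm, ← add_smul] at h
    dsimp only
    linarith
  · intro t s hs x
    refine ⟨⟨s * t.1, mul_nonneg hs.le t.2⟩, ?_⟩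
    have h := hp.smul_le s hs (x + t.1 • z)
    rw [smul_add, smul_smul] at h
    dsimp only
    linarith

/-- Every sup-preserving sublinear functional dominates a linear lattice homomorphism. -/
theorem exists_linearMap_le (hq : IsSupSublinear q) :
    ∃ φ : V →ₗ[ℝ] ℝ, (∀ x y, φ (x ⊔ y) = φ x ⊔ φ y) ∧ ∀ x, φ x ≤ q x := by
  obtain ⟨p, hpq, hp, hmin⟩ := @zorn_le_nonempty₀ (V → ℝ)ᵒᵈ _
    -- The order dual turns Zorn's maximal element into a minimal functional below `q`.
    {p | IsSupSublinear (OrderDual.ofDual p)} (by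
      intro c hc hchain y hy
      have : Nonempty c := ⟨⟨y, hy⟩⟩
      have htot : ∀ i j : c, ∃ k : c, (∀ x, OrderDual.ofDual k.1 x ≤ OrderDual.ofDual i.1 x) ∧
          ∀ x, OrderDual.ofDual k.1 x ≤ OrderDual.ofDual j.1 x := fun i j => by
        rcases hchain.total i.2 j.2 with h | h
        · exact ⟨j, fun x => h x, fun x => le_rfl⟩
        · exact ⟨i, fun x => le_rfl, fun x => h x⟩
      have hbdd : ∀ x, BddBelow (Set.range fun i : c => OrderDual.ofDual i.1 x) := fun x => by
        -- For `k` in the chain below both `i` and `y`: `-y (-x) ≤ -k (-x) ≤ k x ≤ i x`.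
        refine ⟨-(OrderDual.ofDual y) (-x), ?_⟩
        rintro _ ⟨i, rfl⟩
        obtain ⟨k, hki, hky⟩ := htot i ⟨y, hy⟩
        have h := (hc k.2).neg_le_map x
        have h1 := hki x
        have h2 := hky (-x)
        dsimp only at h1 h2 ⊢
        linarith
      refine ⟨OrderDual.toDual fun x => ⨅ i : c, OrderDual.ofDual i.1 x,
        IsSupSublinear.iInf hbdd (fun i => (hc i.2).mono) ?_ ?_ ?_,
        fun z hz x => ciInf_le (hbdd x) ⟨z, hz⟩⟩
      · intro i j x y
        obtain ⟨k, hi, hj⟩ := htot i j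
        exact ⟨k, ((hc k.2).sup_le x y).trans (max_le_max (hi x) (hj y))⟩
      · intro i j x y
        obtain ⟨k, hi, hj⟩ := htot i j
        exact ⟨k, ((hc k.2).add_le x y).trans (add_le_add (hi x) (hj y))⟩
      · intro i s hs x
        exact ⟨i, (hc i.2).smul_le s hs x⟩)
    (OrderDual.toDual q) hq
  change V → ℝ at p
  change IsSupSublinear p at hp
  have hmin' : ∀ p', IsSupSublinear p' → (∀ x, p' x ≤ p x) → ∀ x, p x ≤ p' x :=
    fun p' hp' hle => @hmin (OrderDual.toDual p') hp' hle
  -- The directional minorant lies below `p` (take `t = 0`), so minimality makes it equal to `p`; `t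
  -- = 1` then gives `p (-z) ≤ -p z`. An odd sublinear functional is linear.
  have hneg : ∀ z, p (-z) = -p z := fun z => by
    obtain ⟨hd, hdle⟩ := hp.directional z
    have h1 := hmin' _ hd (fun x => by simpa using hdle x ⟨0, le_rfl⟩) (-z)
    have h2 := hdle (-z) ⟨1, zero_le_one⟩
    simp only [one_smul, neg_add_cancel, hp.map_zero, one_mul, zero_sub] at h2
    have h3 := hp.neg_le_map z
    linarith
  refine ⟨{ toFun := p, map_add' := fun x y => ?_, map_smul' := fun s x => ?_ },
    hp.map_sup, hpq⟩
  · refine le_antisymm (hp.add_le x y) ?_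
    have h := hp.add_le (x + y) (-y)
    rw [add_neg_cancel_right, hneg] at h
    linarith
  · rcases lt_trichotomy s 0 with hs | rfl | hs
    · have h := hp.map_smul_of_pos (neg_pos.2 hs) x
      rw [neg_smul, hneg] at h
      simp only [RingHom.id_apply, smul_eq_mul]
      linarith
    · simp [hp.map_zero]
    · exact hp.map_smul_of_pos hs x

end IsSupSublinear

variable [IsOrderedAddMonoid V] [IsOrderedModule ℝ V]

/-- The real lattice homomorphisms that take the value `1` at a strong unit determine the order
up to arbitrarily small multiples of the unit. -/
theorem le_add_smul_of_forall_latticeHom_le {u : V} (hu : 0 ≤ u) (hunit : ∀ x, ∃ t : ℝ, x ≤ t • u)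
    {f : V} {c : ℝ}
    (hf : ∀ φ : V →ₗ[ℝ] ℝ, (∀ x y, φ (x ⊔ y) = φ x ⊔ φ y) → φ u = 1 → φ f ≤ c) {ε : ℝ}
    (hε : 0 < ε) : f ≤ (c + ε) • u := by
  -- If `u = 0`, the gauge `q` below is not bounded from below, but the strong unit condition
  -- already gives `f ≤ 0`.
  rcases hu.eq_or_lt with rfl | hu0
  · obtain ⟨t, ht⟩ := hunit f
    simpa using ht
  have hbdd : ∀ x, BddBelow {t : ℝ | x ≤ t • u} := fun x => by
    obtain ⟨s, hs⟩ := hunit (-x)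
    refine ⟨-s, fun t ht => ?_⟩
    by_contra! h
    have h1 : 0 ≤ (t + s) • u := by
      rw [add_smul]
      simpa using add_le_add ht hs
    have h2 : 0 ≤ (-(t + s)) • u := smul_nonneg (by linarith) hu
    rw [neg_smul] at h2
    have h3 : (t + s) • u = 0 := le_antisymm (neg_nonneg.1 h2) h1
    rcases smul_eq_zero.1 h3 with h4 | h4
    · linarith
    · exact hu0.ne' h4
  set q : V → ℝ := fun x => sInf {t : ℝ | x ≤ t • u} with hqdef
  have hle : ∀ {x t}, x ≤ t • u → q x ≤ t := fun {x t} h => csInf_le (hbdd x) h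
  have hlt : ∀ {x t}, q x < t → x ≤ t • u := fun {x t} h => by
    obtain ⟨s, hs, hst⟩ := exists_lt_of_csInf_lt (hunit x) h
    exact le_trans hs (smul_le_smul_of_nonneg_right hst.le hu)
  have hq : IsSupSublinear q := by
    refine ⟨fun x y hxy => ?_, fun x y => ?_, fun x y => ?_, fun s hs x => ?_⟩
    · exact le_of_forall_gt_imp_ge_of_dense fun t ht => hle (hxy.trans (hlt ht))
    · exact le_of_forall_gt_imp_ge_of_dense fun t ht =>
        hle (sup_le (hlt ((le_max_left _ _).trans_lt ht)) (hlt ((le_max_right _ _).trans_lt ht)))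
    · refine le_of_forall_pos_le_add fun δ hδ => ?_
      have h1 : x ≤ (q x + δ / 2) • u := hlt (by linarith)
      have h2 : y ≤ (q y + δ / 2) • u := hlt (by linarith)
      have h3 := add_le_add h1 h2
      rw [← add_smul] at h3
      have h4 := hle h3
      linarith
    · refine le_of_forall_pos_le_add fun δ hδ => ?_
      have h1 : x ≤ (q x + δ / s) • u := hlt (lt_add_of_pos_right _ (div_pos hδ hs))
      have h2 := smul_le_smul_of_nonneg_left h1 hs.le
      rw [smul_smul, mul_add, mul_div_cancel₀ _ hs.ne'] at h2
      exact hle h2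
  -- Passing to the minorant in direction `f` before extracting `φ` forces `φ (-f) ≤ -q f`, so `φ`
  -- attains the gauge at `f`.
  obtain ⟨hd, hdle⟩ := hq.directional f
  obtain ⟨φ, hφ, hφle⟩ := hd.exists_linearMap_le
  have hφq : ∀ x, φ x ≤ q x := fun x =>
    (hφle x).trans (by simpa using hdle x ⟨0, le_rfl⟩)
  -- The gauge satisfies `q u ≤ 1` and `q (-u) ≤ -1`, which pins `φ u` from both sides.
  have hφu : φ u = 1 := by
    have h1 : φ u ≤ 1 := (hφq u).trans (hle (by simp))
    have h2 : φ (-u) ≤ -1 := (hφq (-u)).trans (hle (by simp))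
    rw [map_neg] at h2
    linarith
  have hφf : q f ≤ φ f := by
    have h := (hφle (-f)).trans (hdle (-f) ⟨1, zero_le_one⟩)
    simp only [one_smul, neg_add_cancel, hq.map_zero, one_mul, zero_sub, map_neg] at h
    linarith
  exact hlt (by linarith [hf φ hφ hφu])

end Kakutani

/-! ### The concrete model: restriction to `K_L` -/

section ConcreteModel

namespace FiniteNormFn

variable {L : Type u} [Lattice L]

lemma abs_apply_le_norm (f : FiniteNormFn L) (x : Dual L) : |f.1 x| ≤ ‖f‖ := by
  have h := ENNReal.toReal_mono (eNorm_lt_top f).ne (enorm_apply_le_eNorm f.1 x)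
  rwa [toReal_enorm, Real.norm_eq_abs] at h

lemma abs_apply_sub_le_norm (f g : FiniteNormFn L) (x : Dual L) : |f.1 x - g.1 x| ≤ ‖f - g‖ :=
  abs_apply_le_norm (f - g) x

lemma norm_le_of_sum_le {f : FiniteNormFn L} {c : ℝ} (hc : 0 ≤ c)
    (h : ∀ (n : ℕ) (x : Fin n → Dual L), (∀ a, ∑ i, |(x i).1 a| ≤ 1) →
      ∑ i, |f.1 (x i)| ≤ c) : ‖f‖ ≤ c := by
  refine ENNReal.toReal_le_of_le_ofReal hc (eNorm_le fun n x hx => ?_)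
  have h' : ∑ i, ‖f.1 (x i)‖ₑ = ENNReal.ofReal (∑ i, |f.1 (x i)|) := by
    rw [ENNReal.ofReal_sum_of_nonneg fun _ _ => abs_nonneg _]
    exact Finset.sum_congr rfl fun i _ => Real.enorm_eq_ofReal_abs _
  rw [h']
  exact ENNReal.ofReal_le_ofReal (h n x hx)

lemma sum_le_norm (f : FiniteNormFn L) {n : ℕ} (x : Fin n → Dual L)
    (hx : ∀ a, ∑ i, |(x i).1 a| ≤ 1) : ∑ i, |f.1 (x i)| ≤ ‖f‖ := by
  have h := ENNReal.toReal_mono (eNorm_lt_top f).ne (sum_le_eNorm f.1 x hx)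
  rw [ENNReal.toReal_sum fun _ _ => enorm_ne_top] at h
  simp only [toReal_enorm, Real.norm_eq_abs] at h
  exact h

lemma tendsto_apply {ι : Type*} {l : Filter ι} {F : ι → FiniteNormFn L} {f : FiniteNormFn L}
    (h : Filter.Tendsto F l (nhds f)) (x : Dual L) :
    Filter.Tendsto (fun i => (F i).1 x) l (nhds (f.1 x)) := by
  rw [tendsto_iff_norm_sub_tendsto_zero] at h ⊢
  exact squeeze_zero (fun _ => norm_nonneg _) (fun i => abs_apply_sub_le_norm _ _ x) h

instance : CompleteSpace (FiniteNormFn L) := by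
  refine Metric.complete_of_cauchySeq_tendsto fun F hF => ?_
  have hpt : ∀ x, ∃ y, Filter.Tendsto (fun n => (F n).1 x) Filter.atTop (nhds y) := fun x => by
    refine cauchySeq_tendsto_of_complete (Metric.cauchySeq_iff.2 fun ε hε => ?_)
    obtain ⟨N, hN⟩ := Metric.cauchySeq_iff.1 hF ε hε
    refine ⟨N, fun m hm n hn => lt_of_le_of_lt ?_ (hN m hm n hn)⟩
    rw [Real.dist_eq, dist_eq_norm]
    exact abs_apply_sub_le_norm _ _ x
  choose g hg using hpt
  -- The Cauchy estimate on a finite admissible family passes to the pointwise limit, with `N`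
  -- independent of the family. This gives both finite norm of `g` and norm convergence.
  have hbound : ∀ ε > 0, ∃ N, ∀ n ≥ N, ∀ (k : ℕ) (x : Fin k → Dual L),
      (∀ a, ∑ i, |(x i).1 a| ≤ 1) → ∑ i, |(F n).1 (x i) - g (x i)| ≤ ε := fun ε hε => by
    obtain ⟨N, hN⟩ := Metric.cauchySeq_iff.1 hF ε hε
    refine ⟨N, fun n hn k x hx => ?_⟩
    have hlim : Filter.Tendsto (fun m => ∑ i, |(F n).1 (x i) - (F m).1 (x i)|) Filter.atTop
        (nhds (∑ i, |(F n).1 (x i) - g (x i)|)) :=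
      tendsto_finsetSum _ fun i _ => (tendsto_const_nhds.sub (hg (x i))).abs
    refine le_of_tendsto hlim (Filter.eventually_atTop.2 ⟨N, fun m hm => ?_⟩)
    have h := (hN n hn m hm).le
    rw [dist_eq_norm] at h
    exact (sum_le_norm (F n - F m) x hx).trans h
  have hmem : eNorm g < ∞ := by
    obtain ⟨N, hN⟩ := hbound 1 one_pos
    have h1 : eNorm (g - (F N).1) ≤ 1 := eNorm_le fun k x hx => by
      have h' : ∑ i, ‖(g - (F N).1) (x i)‖ₑ =
          ENNReal.ofReal (∑ i, |(F N).1 (x i) - g (x i)|) := by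
        rw [ENNReal.ofReal_sum_of_nonneg fun _ _ => abs_nonneg _]
        refine Finset.sum_congr rfl fun i _ => ?_
        rw [Real.enorm_eq_ofReal_abs, Pi.sub_apply, abs_sub_comm]
      rw [h']
      exact ENNReal.ofReal_le_one.2 (hN N le_rfl k x hx)
    have h2 := eNorm_add_le (g - (F N).1) (F N).1
    rw [sub_add_cancel] at h2
    exact h2.trans_lt (ENNReal.add_lt_top.2 ⟨h1.trans_lt ENNReal.one_lt_top, eNorm_lt_top _⟩)
  refine ⟨⟨g, hmem⟩, Metric.tendsto_atTop.2 fun ε hε => ?_⟩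
  obtain ⟨N, hN⟩ := hbound (ε / 2) (half_pos hε)
  refine ⟨N, fun n hn => ?_⟩
  refine (dist_eq_norm (F n) _).trans_lt ?_
  exact (norm_le_of_sum_le (half_pos hε).le (hN n hn)).trans_lt (half_lt_self hε)

end FiniteNormFn

lemma eval_mem_fblSubmodule {L : Type u} [Lattice L] (a : L) : FiniteNormFn.eval a ∈ fblSubmodule L :=
  Submodule.mem_sInf.2 fun _ hS => hS.2.2.2 a

variable (L : Type u) [Lattice L] [BoundedOrder L]

/-- The functions of finite norm that are positively homogeneous and continuous on `K_L`. -/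
def homogeneousSubmodule : Submodule ℝ (FiniteNormFn L) where
  carrier := {f | (∀ (x y : Dual L) (r : ℝ), 0 ≤ r → (∀ a, x.1 a = r * y.1 a) →
    f.1 x = r * f.1 y) ∧ Continuous fun x : K L => f.1 ⟨x.1, x.2.1⟩}
  add_mem' {f g} hf hg := ⟨fun x y r hr h => by
    change f.1 x + g.1 x = r * (f.1 y + g.1 y)
    rw [hf.1 x y r hr h, hg.1 x y r hr h, mul_add], hf.2.add hg.2⟩
  zero_mem' := ⟨fun x y r _ _ => (mul_zero r).symm, continuous_const⟩
  smul_mem' c f hf := ⟨fun x y r hr h => by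
    change c * f.1 x = r * (c * f.1 y)
    rw [hf.1 x y r hr h, mul_left_comm], hf.2.const_smul c⟩

lemma isClosed_homogeneousSubmodule :
    IsClosed (homogeneousSubmodule L : Set (FiniteNormFn L)) := by
  refine IsSeqClosed.isClosed fun F f hF hf => ⟨fun x y r hr h => ?_, ?_⟩
  · refine tendsto_nhds_unique (FiniteNormFn.tendsto_apply hf x) ?_
    simp only [fun n => (hF n).1 x y r hr h]
    exact (FiniteNormFn.tendsto_apply hf y).const_mul r
  · have hu : TendstoUniformly (fun n (x : K L) => (F n).1 ⟨x.1, x.2.1⟩)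
        (fun x : K L => f.1 ⟨x.1, x.2.1⟩) Filter.atTop := by
      refine Metric.tendstoUniformly_iff.2 fun ε hε => ?_
      filter_upwards [Metric.tendsto_nhds.1 hf ε hε] with n hn x
      rw [dist_comm, Real.dist_eq]
      rw [dist_eq_norm] at hn
      exact (FiniteNormFn.abs_apply_sub_le_norm _ _ _).trans_lt hn
    exact hu.continuous (Filter.Frequently.of_forall fun n => (hF n).2)

/-- Homogeneity and continuity on `K_L` survive lattice operations and norm limits, so the smallest
closed vector sublattice containing the `δ_a` inherits them. -/
lemma fblSubmodule_le_homogeneousSubmodule : fblSubmodule L ≤ homogeneousSubmodule L := by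
  refine sInf_le ⟨isClosed_homogeneousSubmodule L, fun f hf g hg => ⟨fun x y r hr h => ?_, ?_⟩,
    fun f hf g hg => ⟨fun x y r hr h => ?_, ?_⟩, fun a => ⟨fun x y r hr h => h a, ?_⟩⟩
  · change f.1 x ⊔ g.1 x = r * (f.1 y ⊔ g.1 y)
    rw [hf.1 x y r hr h, hg.1 x y r hr h, mul_max_of_nonneg _ _ hr]
  · exact hf.2.sup hg.2
  · change f.1 x ⊓ g.1 x = r * (f.1 y ⊓ g.1 y)
    rw [hf.1 x y r hr h, hg.1 x y r hr h, mul_min_of_nonneg _ _ hr]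
  · exact hf.2.inf hg.2
  · exact (continuous_apply a).comp continuous_subtype_val

instance : CompleteSpace (FBL L) := by
  have h : IsClosed (fblSubmodule L : Set (FiniteNormFn L)) := by
    rw [fblSubmodule, Submodule.coe_sInf]
    exact isClosed_biInter fun S hS => hS.1
  exact h.completeSpace_coe

/-- Restriction of the functions in `FBL⟨L⟩` to `K_L`. -/
noncomputable def restrictCLM : FBL L →L[ℝ] C(K L, ℝ) :=
  LinearMap.mkContinuous
    { toFun := fun f => ⟨fun x => f.1.1 ⟨x.1, x.2.1⟩,
        (fblSubmodule_le_homogeneousSubmodule L f.2).2⟩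
      map_add' := fun _ _ => rfl
      map_smul' := fun _ _ => rfl } 1 fun f => by
    rw [one_mul]
    exact (ContinuousMap.norm_le _ (norm_nonneg f)).2 fun x =>
      FiniteNormFn.abs_apply_le_norm f.1 _

variable {L}

lemma norm_restrictCLM_apply_le (f : FBL L) : ‖restrictCLM L f‖ ≤ ‖f‖ :=
  (ContinuousMap.norm_le _ (norm_nonneg f)).2 fun _ => FiniteNormFn.abs_apply_le_norm f.1 _

lemma abs_apply_le_mul_norm_restrictCLM (f : FBL L) (x : Dual L) :
    |f.1.1 x| ≤ max |x.1 ⊥| |x.1 ⊤| * ‖restrictCLM L f‖ := by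
  have hf := (fblSubmodule_le_homogeneousSubmodule L f.2).1
  set r := max |x.1 ⊥| |x.1 ⊤| with hr
  have hr0 : 0 ≤ r := (abs_nonneg _).trans (le_max_left _ _)
  have hx : ∀ a, |x.1 a| ≤ r := abs_apply_le_max x.2.2.1
  rcases hr0.eq_or_lt with h0 | h0
  -- Here `x = 0 * x`, so homogeneity forces `f x = 0`.
  · have h := hf x x 0 le_rfl fun a => by
      have h := hx a
      rw [← h0] at h
      rw [abs_nonpos_iff.1 h, zero_mul]
    rw [h, zero_mul, abs_zero]
    exact mul_nonneg hr0 (norm_nonneg _)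
  -- Dividing by `r` moves `x` onto the unit sphere `K_L`.
  · have hy : (fun a => r⁻¹ * x.1 a) ∈ compactSet L := by
      have hri : 0 ≤ r⁻¹ := (inv_pos.2 h0).le
      refine ⟨⟨fun a => abs_le.1 ?_, fun a b => ?_, fun a b => ?_⟩, ?_⟩
      · rw [abs_mul, abs_of_nonneg hri]
        calc r⁻¹ * |x.1 a| ≤ r⁻¹ * r := mul_le_mul_of_nonneg_left (hx a) hri
          _ = 1 := inv_mul_cancel₀ h0.ne'
      · change r⁻¹ * x.1 (a ⊔ b) = r⁻¹ * x.1 a ⊔ r⁻¹ * x.1 b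
        rw [x.2.2.1, mul_max_of_nonneg _ _ hri]
      · change r⁻¹ * x.1 (a ⊓ b) = r⁻¹ * x.1 a ⊓ r⁻¹ * x.1 b
        rw [x.2.2.2, mul_min_of_nonneg _ _ hri]
      · rw [abs_mul, abs_mul, abs_of_nonneg hri, ← mul_max_of_nonneg _ _ hri, ← hr,
          inv_mul_cancel₀ h0.ne']
    have h := hf x ⟨_, hy.1⟩ r hr0 fun a => by
      rw [← mul_assoc, mul_inv_cancel₀ h0.ne', one_mul]
    rw [h, abs_mul, abs_of_nonneg hr0]
    exact mul_le_mul_of_nonneg_left ((restrictCLM L f).norm_coe_le_norm ⟨_, hy⟩) hr0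

/-- The constant `2` comes from bounding the maximum by `|x ⊥| + |x ⊤|` and using admissibility at
the two elements `⊥` and `⊤`. -/
lemma norm_le_two_mul_norm_restrictCLM (f : FBL L) : ‖f‖ ≤ 2 * ‖restrictCLM L f‖ := by
  refine FiniteNormFn.norm_le_of_sum_le (mul_nonneg zero_le_two (norm_nonneg _)) fun n x hx => ?_
  calc ∑ i, |f.1.1 (x i)|
      ≤ ∑ i, (|(x i).1 ⊥| + |(x i).1 ⊤|) * ‖restrictCLM L f‖ := Finset.sum_le_sum fun i _ =>
        (abs_apply_le_mul_norm_restrictCLM f (x i)).trans (mul_le_mul_of_nonneg_right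
          (max_le_add_of_nonneg (abs_nonneg _) (abs_nonneg _)) (norm_nonneg _))
    _ = (∑ i, |(x i).1 ⊥| + ∑ i, |(x i).1 ⊤|) * ‖restrictCLM L f‖ := by
        rw [← Finset.sum_mul, Finset.sum_add_distrib]
    _ ≤ 2 * ‖restrictCLM L f‖ := mul_le_mul_of_nonneg_right
        (by linarith [hx ⊥, hx ⊤]) (norm_nonneg _)

variable (L) in
theorem latticeIsomorphicWith_fbl : LatticeIsomorphicWith (FBL L) C(K L, ℝ) 2 :=
  latticeIsomorphicWith_two_of_lowerBound (restrictCLM L) ⟨fun _ _ => rfl, fun _ _ => rfl⟩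
    norm_restrictCLM_apply_le norm_le_two_mul_norm_restrictCLM fun a =>
      ⟨⟨_, eval_mem_fblSubmodule a⟩, fun _ => rfl⟩

end ConcreteModel

/-! ### Free Banach lattices given by the universal property -/

section UniversalProperty

instance hasSolidNorm_continuousMap {α : Type*} [TopologicalSpace α] [CompactSpace α] :
    HasSolidNorm C(α, ℝ) where
  solid f g h := (ContinuousMap.norm_le _ (norm_nonneg g)).2 fun x =>
    le_trans (by simpa using h x) (g.norm_coe_le_norm x)

section Submodule

variable {V : Type*} [AddCommGroup V] [Module ℝ V]

lemma isOrderedAddMonoid_submodule [PartialOrder V] [IsOrderedAddMonoid V] (S : Submodule ℝ V) :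
    IsOrderedAddMonoid S :=
  ⟨fun a b h c => add_le_add_left (show a.1 ≤ b.1 from h) c.1,
    fun a b h c => add_le_add_right (show a.1 ≤ b.1 from h) c.1⟩

lemma isOrderedModule_submodule [PartialOrder V] [IsOrderedModule ℝ V] (S : Submodule ℝ V) :
    IsOrderedModule ℝ S :=
  { smul_le_smul_of_nonneg_left := fun r hr a b h =>
      show r • a.1 ≤ r • b.1 from smul_le_smul_of_nonneg_left (show a.1 ≤ b.1 from h) hr
    smul_le_smul_of_nonneg_right := fun a ha r s h =>
      show r • a.1 ≤ s • a.1 from smul_le_smul_of_nonneg_right h (show 0 ≤ a.1 from ha) }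

variable [Lattice V] [IsOrderedAddMonoid V] [IsOrderedModule ℝ V]

/-- The order ideal generated by a positive element, as a subspace. -/
def orderIdeal (u : V) (_hu : 0 ≤ u) : Submodule ℝ V where
  carrier := {f | ∃ t : ℝ, -f ≤ t • u ∧ f ≤ t • u}
  add_mem' := by
    rintro f g ⟨s, hs⟩ ⟨t, ht⟩
    refine ⟨s + t, ?_, ?_⟩ <;> rw [add_smul]
    · rw [neg_add]
      exact add_le_add hs.1 ht.1
    · exact add_le_add hs.2 ht.2
  zero_mem' := ⟨0, by simp⟩
  smul_mem' := by
    rintro c f ⟨t, ht⟩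
    rcases le_total 0 c with hc | hc
    · refine ⟨c * t, ?_, ?_⟩ <;> rw [mul_smul]
      · rw [← smul_neg]
        exact smul_le_smul_of_nonneg_left ht.1 hc
      · exact smul_le_smul_of_nonneg_left ht.2 hc
    · refine ⟨-c * t, ?_, ?_⟩ <;> rw [mul_smul]
      · rw [← neg_smul]
        exact smul_le_smul_of_nonneg_left ht.2 (neg_nonneg.2 hc)
      · rw [← neg_smul_neg c f]
        exact smul_le_smul_of_nonneg_left ht.1 (neg_nonneg.2 hc)

variable {u : V} {hu : 0 ≤ u}

lemma sup_mem_orderIdeal {f g : V} (hf : f ∈ orderIdeal u hu) (hg : g ∈ orderIdeal u hu) :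
    f ⊔ g ∈ orderIdeal u hu := by
  obtain ⟨s, hs⟩ := hf
  obtain ⟨t, ht⟩ := hg
  exact ⟨max s t, (neg_le_neg le_sup_left).trans (hs.1.trans
      (smul_le_smul_of_nonneg_right (le_max_left s t) hu)),
    sup_le (hs.2.trans (smul_le_smul_of_nonneg_right (le_max_left s t) hu))
      (ht.2.trans (smul_le_smul_of_nonneg_right (le_max_right s t) hu))⟩

lemma inf_mem_orderIdeal {f g : V} (hf : f ∈ orderIdeal u hu) (hg : g ∈ orderIdeal u hu) :
    f ⊓ g ∈ orderIdeal u hu := by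
  have h := (orderIdeal u hu).neg_mem (sup_mem_orderIdeal ((orderIdeal u hu).neg_mem hf)
    ((orderIdeal u hu).neg_mem hg))
  rwa [neg_sup, neg_neg, neg_neg] at h

instance : Lattice (orderIdeal u hu) :=
  Subtype.lattice (fun _ _ => sup_mem_orderIdeal) (fun _ _ => inf_mem_orderIdeal)

instance : IsOrderedAddMonoid (orderIdeal u hu) := isOrderedAddMonoid_submodule _

instance : IsOrderedModule ℝ (orderIdeal u hu) := isOrderedModule_submodule _

lemma map_inf_of_map_sup {V : Type*} [AddCommGroup V] [Module ℝ V] [Lattice V]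
    [IsOrderedAddMonoid V] (φ : V →ₗ[ℝ] ℝ) (hφ : ∀ x y, φ (x ⊔ y) = φ x ⊔ φ y) (x y : V) :
    φ (x ⊓ y) = φ x ⊓ φ y := by
  have h := hφ (-x) (-y)
  rw [← neg_inf, map_neg, map_neg, map_neg, ← neg_inf] at h
  exact neg_injective h

end Submodule

variable {L : Type u} [Lattice L] {X : Type v} [NormedAddCommGroup X] [NormedSpace ℝ X] [Lattice X]
  {δ : LatticeHom L X}

namespace IsFreeBanachLattice

/-- A free Banach lattice extends lattice homomorphisms `L → [-1, 1]` to contractive real lattice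
homomorphisms. -/
lemma exists_real_extension (hδ : IsFreeBanachLattice δ) (x : Dual L) :
    ∃ φ : X →L[ℝ] ℝ, IsBanachLatticeHom φ ∧ (∀ a, φ (δ a) = x.1 a) ∧ ∀ f, |φ f| ≤ ‖f‖ := by
  -- Continuous functions on one point serve as a copy of `ℝ` in the universe `v` over which the
  -- universal property quantifies.
  let T : LatticeHom L C(PUnit.{v + 1}, ℝ) :=
    { toFun := fun a => ContinuousMap.const _ (x.1 a)
      map_sup' := fun a b => by ext; exact x.2.2.1 a b
      map_inf' := fun a b => by ext; exact x.2.2.2 a b }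
  have hT : ∀ a, ‖T a‖ ≤ 1 := fun a => (ContinuousMap.norm_le _ zero_le_one).2 fun _ =>
    abs_le.2 ⟨(x.2.1 a).1, (x.2.1 a).2⟩
  obtain ⟨T', hT', hext, hnorm, -⟩ := hδ.exists_unique_extension C(PUnit.{v + 1}, ℝ) T
    (isBounded_iff_forall_norm_le.2 ⟨1, by rintro _ ⟨a, rfl⟩; exact hT a⟩)
  have hT1 : ‖T'‖ ≤ 1 := hnorm ▸ Real.iSup_le hT zero_le_one
  refine ⟨(ContinuousMap.evalCLM ℝ PUnit.unit).comp T',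
    ⟨fun f g => ?_, fun f g => ?_⟩, fun a => ?_, fun f => ?_⟩
  · exact congrArg (fun h : C(PUnit.{v + 1}, ℝ) => h PUnit.unit) (hT'.1 f g)
  · exact congrArg (fun h : C(PUnit.{v + 1}, ℝ) => h PUnit.unit) (hT'.2 f g)
  · exact congrArg (fun h : C(PUnit.{v + 1}, ℝ) => h PUnit.unit) (hext a)
  · calc |T' f PUnit.unit| ≤ ‖T' f‖ := (T' f).norm_coe_le_norm PUnit.unit
      _ ≤ ‖T'‖ * ‖f‖ := T'.le_opNorm f
      _ ≤ 1 * ‖f‖ := mul_le_mul_of_nonneg_right hT1 (norm_nonneg f)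
      _ = ‖f‖ := one_mul _

/-- The extension of `x : L → [-1, 1]` to the free Banach lattice. -/
noncomputable def extend (hδ : IsFreeBanachLattice δ) (x : Dual L) : X →L[ℝ] ℝ :=
  (hδ.exists_real_extension x).choose

lemma extend_spec (hδ : IsFreeBanachLattice δ) (x : Dual L) :
    IsBanachLatticeHom (hδ.extend x) ∧ (∀ a, hδ.extend x (δ a) = x.1 a) ∧
      ∀ f, |hδ.extend x f| ≤ ‖f‖ :=
  (hδ.exists_real_extension x).choose_spec

variable [IsOrderedAddMonoid X] [IsOrderedModule ℝ X] [HasSolidNorm X] [CompleteSpace X]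

/-- The identity of `X` is the extension of `δ` itself, so `sup ‖δ a‖` equals its norm, which is at
most `1`. -/
lemma norm_apply_le_one (hδ : IsFreeBanachLattice δ) (a : L) : ‖δ a‖ ≤ 1 := by
  obtain ⟨T', -, -, hnorm, huniq⟩ := hδ.exists_unique_extension X δ hδ.isBounded_range
  have hid : ContinuousLinearMap.id ℝ X = T' :=
    huniq _ ⟨fun _ _ => rfl, fun _ _ => rfl⟩ fun _ => rfl
  obtain ⟨C, hC⟩ := isBounded_iff_forall_norm_le.1 hδ.isBounded_range
  have hb : BddAbove (Set.range fun a => ‖δ a‖) :=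
    ⟨C, by rintro _ ⟨a, rfl⟩; exact hC _ ⟨a, rfl⟩⟩
  calc ‖δ a‖ ≤ ⨆ a, ‖δ a‖ := le_ciSup hb a
    _ = ‖ContinuousLinearMap.id ℝ X‖ := by rw [hid, hnorm]
    _ ≤ 1 := ContinuousLinearMap.norm_id_le

/-- The free Banach lattice is generated by the lattice as a closed vector sublattice. -/
lemma mem_of_isClosed (hδ : IsFreeBanachLattice δ) (S : Submodule ℝ X)
    (hS : IsClosed (S : Set X)) (hsup : ∀ f ∈ S, ∀ g ∈ S, f ⊔ g ∈ S)
    (hinf : ∀ f ∈ S, ∀ g ∈ S, f ⊓ g ∈ S) (hmem : ∀ a, δ a ∈ S) (f : X) : f ∈ S := by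
  let _ : Lattice S := Subtype.lattice (fun _ _ hf hg => hsup _ hf _ hg)
    (fun _ _ hf hg => hinf _ hf _ hg)
  have : IsOrderedAddMonoid S := isOrderedAddMonoid_submodule S
  have : IsOrderedModule ℝ S := isOrderedModule_submodule S
  have : HasSolidNorm S :=
    ⟨fun a b h => norm_le_norm_of_abs_le_abs (a := a.1) (b := b.1) h⟩
  have : CompleteSpace S := hS.completeSpace_coe
  let T : LatticeHom L S :=
    { toFun := fun a => ⟨δ a, hmem a⟩
      map_sup' := fun a b => Subtype.ext (map_sup δ a b)
      map_inf' := fun a b => Subtype.ext (map_inf δ a b) }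
  obtain ⟨T', hT', hext, -, -⟩ := hδ.exists_unique_extension S T
    (isBounded_iff_forall_norm_le.2 ⟨1, by rintro _ ⟨a, rfl⟩; exact hδ.norm_apply_le_one a⟩)
  obtain ⟨R, -, -, -, huniq⟩ := hδ.exists_unique_extension X δ hδ.isBounded_range
  have h1 : ContinuousLinearMap.id ℝ X = R :=
    huniq _ ⟨fun _ _ => rfl, fun _ _ => rfl⟩ fun _ => rfl
  -- Extending into `S` and including back also extends `δ`; uniqueness identifies this with the
  -- identity, so all of `X` lies in `S`.
  have h2 : S.subtypeL.comp T' = R :=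
    huniq _ ⟨fun x y => congrArg Subtype.val (hT'.1 x y),
      fun x y => congrArg Subtype.val (hT'.2 x y)⟩ fun a => congrArg Subtype.val (hext a)
  have h3 : ((T' f : S) : X) = f := DFunLike.congr_fun (h2.trans h1.symm) f
  exact h3 ▸ (T' f).2

variable [BoundedOrder L]

/-- The elements with continuous representation form a closed vector sublattice containing every `δ
a`: contractivity of the extensions turns norm limits into uniform limits. -/
lemma continuous_extend (hδ : IsFreeBanachLattice δ) (f : X) :
    Continuous fun x : K L => hδ.extend ⟨x.1, x.2.1⟩ f := by
  let S : Submodule ℝ X :=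
    { carrier := {f | Continuous fun x : K L => hδ.extend ⟨x.1, x.2.1⟩ f}
      add_mem' := fun {f g} hf hg => (Continuous.add hf hg).congr fun x => (map_add _ f g).symm
      zero_mem' := by simpa only [Set.mem_ofPred_eq, map_zero] using continuous_const
      smul_mem' := fun c f hf => (Continuous.const_smul hf c).congr fun x =>
        (map_smul _ c f).symm }
  refine hδ.mem_of_isClosed S ?_ (fun f hf g hg => ?_) (fun f hf g hg => ?_) (fun a => ?_) f
  · refine IsSeqClosed.isClosed fun F f hF hf => ?_
    have hu : TendstoUniformly (fun n (x : K L) => hδ.extend ⟨x.1, x.2.1⟩ (F n))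
        (fun x : K L => hδ.extend ⟨x.1, x.2.1⟩ f) Filter.atTop := by
      refine Metric.tendstoUniformly_iff.2 fun ε hε => ?_
      filter_upwards [Metric.tendsto_nhds.1 hf ε hε] with n hn x
      rw [dist_comm, Real.dist_eq, ← map_sub]
      rw [dist_eq_norm] at hn
      exact ((hδ.extend_spec _).2.2 _).trans_lt hn
    exact hu.continuous (Filter.Frequently.of_forall hF)
  · change Continuous fun x : K L => hδ.extend ⟨x.1, x.2.1⟩ (f ⊔ g)
    simp only [(hδ.extend_spec _).1.1]
    exact Continuous.sup hf hg
  · change Continuous fun x : K L => hδ.extend ⟨x.1, x.2.1⟩ (f ⊓ g)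
    simp only [(hδ.extend_spec _).1.2]
    exact Continuous.inf hf hg
  · change Continuous fun x : K L => hδ.extend ⟨x.1, x.2.1⟩ (δ a)
    simp only [(hδ.extend_spec _).2.1]
    exact (continuous_apply a).comp continuous_subtype_val

/-- The representation of a free Banach lattice as continuous functions on `K_L`. -/
noncomputable def toContinuousMap (hδ : IsFreeBanachLattice δ) : X →L[ℝ] C(K L, ℝ) :=
  LinearMap.mkContinuous
    { toFun := fun f => ⟨fun x => hδ.extend ⟨x.1, x.2.1⟩ f, hδ.continuous_extend f⟩
      map_add' := fun f g => by ext; simp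
      map_smul' := fun c f => by ext; simp } 1 fun f => by
    rw [one_mul]
    exact (ContinuousMap.norm_le _ (norm_nonneg f)).2 fun x => (hδ.extend_spec _).2.2 f

lemma norm_toContinuousMap_apply_le (hδ : IsFreeBanachLattice δ) (f : X) :
    ‖hδ.toContinuousMap f‖ ≤ ‖f‖ :=
  (ContinuousMap.norm_le _ (norm_nonneg f)).2 fun _ => (hδ.extend_spec _).2.2 f

lemma isBanachLatticeHom_toContinuousMap (hδ : IsFreeBanachLattice δ) :
    IsBanachLatticeHom hδ.toContinuousMap :=
  ⟨fun f g => ContinuousMap.ext fun _ => (hδ.extend_spec _).1.1 f g,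
    fun f g => ContinuousMap.ext fun _ => (hδ.extend_spec _).1.2 f g⟩

lemma norm_le_two_mul_norm_toContinuousMap (hδ : IsFreeBanachLattice δ) (f : X) :
    ‖f‖ ≤ 2 * ‖hδ.toContinuousMap f‖ := by
  -- This element represents the constant `1` on `K_L`; its norm bound is the source of the factor
  -- `2`.
  set u : X := |δ ⊥| ⊔ |δ ⊤| with hudef
  have hu : 0 ≤ u := (abs_nonneg _).trans le_sup_left
  have hunorm : ‖u‖ ≤ 2 := by
    have h1 : |u| ≤ |(|δ ⊥| + |δ ⊤|)| := by
      rw [abs_of_nonneg hu, abs_of_nonneg (add_nonneg (abs_nonneg _) (abs_nonneg _))]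
      exact sup_le (le_add_of_nonneg_right (abs_nonneg _)) (le_add_of_nonneg_left (abs_nonneg _))
    have h2 := (norm_le_norm_of_abs_le_abs h1).trans (norm_add_le _ _)
    rw [norm_abs_eq_norm, norm_abs_eq_norm] at h2
    linarith [hδ.norm_apply_le_one ⊥, hδ.norm_apply_le_one ⊤]
  have hδI : ∀ a, δ a ∈ orderIdeal u hu := fun a => by
    refine ⟨1, ?_, ?_⟩ <;> rw [one_smul]
    · exact (neg_le_neg (OrderHomClass.mono δ bot_le)).trans
        ((neg_le_abs _).trans le_sup_left)
    · exact (OrderHomClass.mono δ le_top).trans ((le_abs_self _).trans le_sup_right)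
  have huI : u ∈ orderIdeal u hu := ⟨1, by
    rw [one_smul]; exact (neg_nonpos.2 hu).trans hu, by rw [one_smul]⟩
  -- A lattice homomorphism `φ` on the ideal need not be continuous for the norm of `X`, so its
  -- agreement with `hδ.extend x` is propagated only through algebraic operations. Hence `A` is not
  -- claimed to be closed.
  let A : Submodule ℝ X :=
    { carrier := {f | ∃ h : f ∈ orderIdeal u hu, ∀ (φ : orderIdeal u hu →ₗ[ℝ] ℝ) (x : Dual L),
        (∀ f g, φ (f ⊔ g) = φ f ⊔ φ g) → (∀ a, φ ⟨δ a, hδI a⟩ = x.1 a) →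
          φ ⟨f, h⟩ = hδ.extend x f}
      add_mem' := by
        rintro f g ⟨hf, hf'⟩ ⟨hg, hg'⟩
        refine ⟨Submodule.add_mem _ hf hg, fun φ x hφ hx => ?_⟩
        rw [map_add, ← hf' φ x hφ hx, ← hg' φ x hφ hx, ← map_add]
        rfl
      zero_mem' := ⟨Submodule.zero_mem _, fun φ x _ _ => by
        rw [map_zero]
        exact map_zero φ⟩
      smul_mem' := by
        rintro c f ⟨hf, hf'⟩
        refine ⟨Submodule.smul_mem _ c hf, fun φ x hφ hx => ?_⟩
        rw [map_smul, ← hf' φ x hφ hx, ← map_smul]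
        rfl }
  have hAsup : ∀ f ∈ A, ∀ g ∈ A, f ⊔ g ∈ A := by
    rintro f ⟨hf, hf'⟩ g ⟨hg, hg'⟩
    refine ⟨sup_mem_orderIdeal hf hg, fun φ x hφ hx => ?_⟩
    rw [(hδ.extend_spec x).1.1, ← hf' φ x hφ hx, ← hg' φ x hφ hx, ← hφ]
    rfl
  have hAinf : ∀ f ∈ A, ∀ g ∈ A, f ⊓ g ∈ A := by
    rintro f ⟨hf, hf'⟩ g ⟨hg, hg'⟩
    refine ⟨inf_mem_orderIdeal hf hg, fun φ x hφ hx => ?_⟩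
    rw [(hδ.extend_spec x).1.2, ← hf' φ x hφ hx, ← hg' φ x hφ hx, ← map_inf_of_map_sup φ hφ]
    rfl
  have hAδ : ∀ a, δ a ∈ A := fun a =>
    ⟨hδI a, fun φ x _ hx => (hx a).trans ((hδ.extend_spec x).2.1 a).symm⟩
  have hAle : ∀ f ∈ A, ∀ ε > 0, f ≤ (‖hδ.toContinuousMap f‖ + ε) • u := by
    rintro f ⟨hf, hf'⟩ ε hε
    refine le_add_smul_of_forall_latticeHom_le (V := orderIdeal u hu) (u := ⟨u, huI⟩)
      (f := ⟨f, hf⟩) hu (fun x => x.2.imp fun t ht => ht.2) (fun φ hφ hφu => ?_) hε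
    set x : L → ℝ := fun a => φ ⟨δ a, hδI a⟩ with hxdef
    have hxsup : ∀ a b, x (a ⊔ b) = x a ⊔ x b := fun a b => by
      rw [hxdef, ← hφ]
      exact congrArg φ (Subtype.ext (map_sup δ a b))
    have hxinf : ∀ a b, x (a ⊓ b) = x a ⊓ x b := fun a b => by
      rw [hxdef, ← map_inf_of_map_sup φ hφ]
      exact congrArg φ (Subtype.ext (map_inf δ a b))
    -- Since `φ` preserves suprema, this maximum is `φ u = 1`, so `φ ∘ δ` is a point of `K_L`.
    have hxmax : max |x ⊥| |x ⊤| = 1 := by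
      rw [← hφu, abs, abs, hxdef, ← map_neg, ← map_neg, ← hφ, ← hφ, ← hφ]
      rfl
    have hxK : x ∈ compactSet L := ⟨⟨fun a => abs_le.1 (hxmax ▸ abs_apply_le_max hxsup a),
      hxsup, hxinf⟩, hxmax⟩
    rw [hf' φ ⟨x, hxK.1⟩ hφ fun _ => rfl]
    exact (le_abs_self _).trans ((hδ.toContinuousMap f).norm_coe_le_norm ⟨x, hxK⟩)
  have hAnorm : ∀ f ∈ A, ‖f‖ ≤ 2 * ‖hδ.toContinuousMap f‖ := fun f hf => by
    refine le_of_forall_pos_le_add fun ε hε => ?_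
    have h1 := hAle f hf (ε / 2) (half_pos hε)
    have h2 := hAle (-f) (A.neg_mem hf) (ε / 2) (half_pos hε)
    rw [map_neg, norm_neg] at h2
    have h0 : 0 ≤ ‖hδ.toContinuousMap f‖ + ε / 2 :=
      add_nonneg (norm_nonneg _) (half_pos hε).le
    have h3 : |f| ≤ |(‖hδ.toContinuousMap f‖ + ε / 2) • u| := by
      rw [abs_of_nonneg (smul_nonneg h0 hu)]
      exact sup_le h1 h2
    calc ‖f‖ ≤ ‖(‖hδ.toContinuousMap f‖ + ε / 2) • u‖ := norm_le_norm_of_abs_le_abs h3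
      _ = (‖hδ.toContinuousMap f‖ + ε / 2) * ‖u‖ := by
        rw [norm_smul, Real.norm_of_nonneg h0]
      _ ≤ (‖hδ.toContinuousMap f‖ + ε / 2) * 2 := mul_le_mul_of_nonneg_left hunorm h0
      _ = 2 * ‖hδ.toContinuousMap f‖ + ε := by ring
  have hclosed : IsClosed {f : X | ‖f‖ ≤ 2 * ‖hδ.toContinuousMap f‖} :=
    isClosed_le continuous_norm (hδ.toContinuousMap.continuous.norm.const_mul 2)
  -- The bound is a closed condition, and the closure of `A` is a closed vector sublattice
  -- containing all `δ a`, hence all of `X`.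
  refine closure_minimal hAnorm hclosed (hδ.mem_of_isClosed A.topologicalClosure
    A.isClosed_topologicalClosure (fun f hf g hg => ?_) (fun f hf g hg => ?_)
    (fun a => A.le_topologicalClosure (hAδ a)) f)
  · exact map_mem_closure₂ continuous_sup hf hg hAsup
  · exact map_mem_closure₂ continuous_inf hf hg hAinf

theorem latticeIsomorphicWith (hδ : IsFreeBanachLattice δ) :
    LatticeIsomorphicWith X C(K L, ℝ) 2 :=
  latticeIsomorphicWith_two_of_lowerBound hδ.toContinuousMap hδ.isBanachLatticeHom_toContinuousMap
    hδ.norm_toContinuousMap_apply_le hδ.norm_le_two_mul_norm_toContinuousMap fun a =>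
      ⟨δ a, fun _ => (hδ.extend_spec _).2.1 a⟩

end IsFreeBanachLattice

end UniversalProperty

end FreeBanachLattice

theorem theorem2p7 (L : Type u) [DistribLattice L] [BoundedOrder L] :
    FreeBanachLattice.LatticeIsomorphicWith (FreeBanachLattice.FBL L)
      C(FreeBanachLattice.K L, ℝ) 2 ∧
    ∀ (X : Type v) [NormedAddCommGroup X] [NormedSpace ℝ X] [Lattice X] [IsOrderedAddMonoid X]
      [IsOrderedModule ℝ X] [HasSolidNorm X] [CompleteSpace X] (δ : LatticeHom L X),
      FreeBanachLattice.IsFreeBanachLattice δ →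
        FreeBanachLattice.LatticeIsomorphicWith X C(FreeBanachLattice.K L, ℝ) 2 :=
  ⟨FreeBanachLattice.latticeIsomorphicWith_fbl L, fun _ _ _ _ _ _ _ _ _ hδ =>
    hδ.latticeIsomorphicWith⟩
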